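/- Let $N,n\in\mathbb N$. Let $A=(a_{ij})\in\mathbb R^{N\times N}$, $a_{ij}\ge 0$, $a_{ii}=0$, be the weights of a digraph on the followers $1,\dots,N$, $\mathcal N_i=\{j: a_{ij}>0\}$; let $\sigma_{ij}>0$ if $a_{ij}>0$ and $\sigma_{ij}=0$ otherwise; let $\kappa_i\ge 0$ (pinning gains), $c_1,c_2,\beta_1,\beta_2\in\mathbb R$, $\tau\ge 0$, and let $f:\mathbb R^n\times\mathbb R^n\to\mathbb R^n$ be Lipschitz. Let $0=t_0<s_0\le t_1<s_1\le\cdots$ with $t_k\to\infty$. Let $W$ be a standard real Brownian motion relative to a complete filtration $(\mathcal F_t)_{t\ge 0}$ on a complete probability space. The leader is a deterministic solution of $\dot x_0=v_0$, $\dot v_0=f(x_0,v_0)$ on $[-\tau,\infty)$; write $t_\tau=t-\tau$. The followers obey (in the Itô sense, $w=\dot W$) $$\dot x_i=v_i,\qquad \dot v_i=f(x_i,v_i)+c_1\sum_{j\in\mathcal N_i}a_{ij}(x_j-x_i)+c_2\sum_{j\in\mathcal N_i}a_{ij}(v_j-v_i)+u_i,$$ where, for $t\in[t_k,s_k]$ (control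 active), $$u_i=-\kappa_i\big(c_1(x_i-x_0(t_\tau))+c_2(v_i-v_0(t_\tau))\big)-\sum_{j\in\mathcal N_i}\sigma_{ij}\big(\beta_1(x_i-x_j)+\beta_2(v_i-v_j)\big)w(t),$$ and $u_i=0$ for $t\in(s_k,t_{k+1})$ (failure). The noise in $u_i$ is the sum over $j\in\mathcal N_i$ of the errors $z_j^x-x_j$, $z_j^v-v_j$ of the digital-twin perceptions $z_j^x=x_j+\beta_1\sigma_{ij}(x_j-x_i)w$, $z_j^v=v_j+\beta_2\sigma_{ij}(v_j-v_i)w$. Solutions are adapted with almost surely continuous paths and square-integrable $\mathcal F_0$-measurable initial state. Let $\tilde x_i(t)=x_i(t)-x_0(t_\tau)$, $\tilde v_i(t)=v_i(t)-v_0(t_\tau)$ and $\xi=(\tilde x_1^\top,\dots,\tilde x_N^\top,\tilde v_1^\top,\dots,\tilde v_N^\top)^\top\in\mathbb R^{2Nn}$. Let $L$ be the Laplacian of $A$, $K=\mathrm{diag}(\kappa_1,\dots,\kappa_N)$, $\tilde L=L+K$, $D=(d_{ij})$ with $d_{ij}=-\sigma_{ij}$ $(i\ne j)$, $d_{ii}=\sum_j\sigma_{ij}$,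 and $$H_1=\begin{pmatrix}0&I_N\\-c_1\tilde L&-c_2\tilde L\end{pmatrix},\quad H_2=\begin{pmatrix}0&I_N\\-c_1L&-c_2L\end{pmatrix},\quad U=\begin{pmatrix}0&0\\\beta_1D&\beta_2D\end{pmatrix},$$ and let $\widetilde F_\tau(t)\in\mathbb R^{2Nn}$ have position part $0$ and velocity blocks $f(x_i(t),v_i(t))-f(x_0(t_\tau),v_0(t_\tau))$, where $x_i=\tilde x_i+x_0(t_\tau)$, $v_i=\tilde v_i+v_0(t_\tau)$. Then, for every leader trajectory, $(x,v)$ is a solution of the followers' system if and only if its lag error $\xi$ is a solution of the stochastic error dynamics $$d\xi=\big(\widetilde F_\tau+(H_1\otimes I_n)\xi\big)dt-(U\otimes I_n)\xi\,dW\ \ (t\in[t_k,s_k]),\qquad d\xi=\big(\widetilde F_\tau+(H_2\otimes I_n)\xi\big)dt\ \ (t\in(s_k,t_{k+1})),\qquad k\ge 0.$$ Consequently mean-square lag consensus, i.e. $\mathbb E\|\tilde x_i(t)\|^2\to0$ and $\mathbb E\|\tilde v_i(t)\|^2\to0$ as $t\to\infty$ for all $i$ and all initial states, is equivalent to mean-square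 stability of the error dynamics, i.e. $\mathbb E\|\xi(t)\|^2\to0$ as $t\to\infty$ for all initial errors. This holds for each fixed leader trajectory, and also when both properties are required for all leader trajectories. -/

import Mathlib

open MeasureTheory ProbabilityTheory Filter Topology Set
open scoped NNReal ENNReal Kronecker

namespace LagConsensus

noncomputable section

/-! ### Brownian motion and the Itô integral -/

/-- `W` is a standard real Brownian motion relative to the filtration `𝓕`: it is a Brownian motion,
it is adapted, its increments after time `s` are independent of `𝓕 s`, and all null sets belong to
`𝓕 0` (so that the probability space and the filtration are complete). The completed natural
filtration of a Brownian motion is an instance. -/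
structure IsFilteredBrownian {Ω : Type*} [mΩ : MeasurableSpace Ω] (𝓕 : Filtration ℝ≥0 mΩ)
    (W : ℝ≥0 → Ω → ℝ) (P : Measure Ω) : Prop where
  isBrownian : IsBrownianReal W P
  adapted : StronglyAdapted 𝓕 W
  indep_increments : ∀ s t : ℝ≥0, s ≤ t →
    Indep (MeasurableSpace.comap (fun ω => W t ω - W s ω) inferInstance) (𝓕 s) P
  null_sets : ∀ A : Set Ω, P A = 0 → MeasurableSet[𝓕 0] A

/-- A simple (elementary predictable) process `∑_{i < num} val i · 1_{(time i, time (i+1)]}`, with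
each `val i` bounded and measurable with respect to `𝓕 (time i)`. -/
structure SimpleProcess {Ω : Type*} [mΩ : MeasurableSpace Ω] (𝓕 : Filtration ℝ≥0 mΩ)
    (E : Type*) [NormedAddCommGroup E] where
  num : ℕ
  time : ℕ → ℝ≥0
  time_mono : Monotone time
  val : ℕ → Ω → E
  val_meas : ∀ i, StronglyMeasurable[𝓕 (time i)] (val i)
  val_bdd : ∃ C : ℝ, ∀ i ω, ‖val i ω‖ ≤ C

section Ito

variable {Ω : Type*} [mΩ : MeasurableSpace Ω] {𝓕 : Filtration ℝ≥0 mΩ}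
  {E : Type*} [NormedAddCommGroup E] [NormedSpace ℝ E]

/-- The value at time `t` of a simple process. -/
def SimpleProcess.eval (H : SimpleProcess 𝓕 E) (t : ℝ≥0) (ω : Ω) : E :=
  ∑ i ∈ Finset.range H.num, (Ioc (H.time i) (H.time (i + 1))).indicator (fun _ => H.val i ω) t

/-- The elementary stochastic integral `∫_a^b H dW` of a simple process (for `a ≤ b`): the jump
times are truncated to `[a, b]`. -/
def SimpleProcess.integral (H : SimpleProcess 𝓕 E) (W : ℝ≥0 → Ω → ℝ) (a b : ℝ≥0) (ω : Ω) : E :=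
  ∑ i ∈ Finset.range H.num,
    (W (max a (min (H.time (i + 1)) b)) ω - W (max a (min (H.time i) b)) ω) • H.val i ω

/-- `I` is (a version of) the Itô integral `∫_a^b G dW`: there are simple processes `H k` with
`∫_a^b ‖H k - G‖² dr → 0` in probability and `∫_a^b H k dW → I` in probability. -/
def IsItoIntegral (𝓕 : Filtration ℝ≥0 mΩ) (W : ℝ≥0 → Ω → ℝ) (P : Measure Ω)
    (G : ℝ≥0 → Ω → E) (a b : ℝ≥0) (I : Ω → E) : Prop :=
  ∃ H : ℕ → SimpleProcess 𝓕 E,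
    (∀ ε : ℝ≥0∞, 0 < ε → Tendsto (fun k => P {ω | ε ≤ ∫⁻ r in Icc (a : ℝ) (b : ℝ),
      ‖(H k).eval r.toNNReal ω - G r.toNNReal ω‖ₑ ^ 2}) atTop (𝓝 0)) ∧
    TendstoInMeasure P (fun k => (H k).integral W a b) atTop I

/-- The process `y` satisfies the Itô equation `dy = b(t, y) dt + g(t, y) dW` for `t ∈ [a, c]`. -/
def SolvesSDEOn (𝓕 : Filtration ℝ≥0 mΩ) (W : ℝ≥0 → Ω → ℝ) (P : Measure Ω)
    (b g : ℝ≥0 → E → E) (y : ℝ≥0 → Ω → E) (a c : ℝ≥0) : Prop :=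
  ∀ t ∈ Icc a c, ∃ I : Ω → E, IsItoIntegral 𝓕 W P (fun r ω => g r (y r ω)) a t I ∧
    ∀ᵐ ω ∂P, y t ω = y a ω
      + (∫ r in (a : ℝ)..(t : ℝ), b r.toNNReal (y r.toNNReal ω)) + I ω

/-- Almost every path of `y` satisfies the ordinary differential equation `dy = b(t, y) dt` for
`t ∈ (a, c)`. -/
def SolvesODEOn (P : Measure Ω) (b : ℝ≥0 → E → E) (y : ℝ≥0 → Ω → E) (a c : ℝ≥0) : Prop :=
  ∀ᵐ ω ∂P, ∀ t ∈ Ioo a c,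
    HasDerivAt (fun r : ℝ => y r.toNNReal ω) (b t (y t ω)) (t : ℝ)

end Ito

/-! ### Switching between control-active and failure intervals -/

/-- The times `0 = t₀ < s₀ ≤ t₁ < s₁ ≤ ⋯ → ∞`: the control input is active on `[t k, s k]` and
fails on `(s k, t (k+1))`. -/
structure Schedule where
  t : ℕ → ℝ≥0
  s : ℕ → ℝ≥0
  t_zero : t 0 = 0
  t_lt_s : ∀ k, t k < s k
  s_le_t : ∀ k, s k ≤ t (k + 1)
  t_tendsto : Tendsto t atTop atTop

/-- `y` is a solution on `[0, ∞)` of the piecewise system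
`dy = b₁(t, y) dt + g₁(t, y) dW` on `[t k, s k]`, `dy = b₂(t, y) dt` on `(s k, t (k+1))`,
with square-integrable (`𝓕 0`-measurable) initial state: it is adapted, has almost surely
continuous paths, and satisfies the respective equation on every interval. -/
structure IsPiecewiseSolution {Ω : Type*} [mΩ : MeasurableSpace Ω] {E : Type*}
    [NormedAddCommGroup E] [NormedSpace ℝ E] (𝓕 : Filtration ℝ≥0 mΩ) (W : ℝ≥0 → Ω → ℝ)
    (P : Measure Ω) (S : Schedule) (b₁ g₁ b₂ : ℝ≥0 → E → E) (y : ℝ≥0 → Ω → E) : Prop where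
  adapted : StronglyAdapted 𝓕 y
  continuous_paths : ∀ᵐ ω ∂P, Continuous fun t => y t ω
  initial : MemLp (y 0) 2 P
  active : ∀ k, SolvesSDEOn 𝓕 W P b₁ g₁ y (S.t k) (S.s k)
  failure : ∀ k, SolvesODEOn P b₂ y (S.s k) (S.t (k + 1))

/-! ### The leader–follower network -/

/-- The space `ℝⁿ` of positions (and of velocities) of one agent. -/
abbrev Space (n : ℕ) := EuclideanSpace ℝ (Fin n)

/-- The joint state of the followers: `y.1 i` is the position `xᵢ`, `y.2 i` the velocity `vᵢ`. -/
abbrev FollowerState (N n : ℕ) := (Fin N → Space n) × (Fin N → Space n)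

/-- The space of stacked errors `ξ = (x̃₁, …, x̃_N, ṽ₁, …, ṽ_N) ∈ ℝ^{2Nn}`: the entry `(inl i, l)` is
coordinate `l` of `x̃ᵢ`, the entry `(inr i, l)` is coordinate `l` of `ṽᵢ`. -/
abbrev ErrorSpace (N n : ℕ) := EuclideanSpace ℝ ((Fin N ⊕ Fin N) × Fin n)

/-- Data of the network: weights `a i j ≥ 0` of a digraph without self-loops (`a i j > 0` iff agent
`i` receives information from agent `j`), noise gains `σ i j`, positive exactly on the edges and
zero elsewhere, pinning gains `κ i ≥ 0`, coupling strengths `c₁, c₂`, noise intensities `β₁, β₂`,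
and the intrinsic dynamics `f`. -/
structure Network (N n : ℕ) where
  a : Matrix (Fin N) (Fin N) ℝ
  a_nonneg : ∀ i j, 0 ≤ a i j
  a_diag : ∀ i, a i i = 0
  σ : Matrix (Fin N) (Fin N) ℝ
  σ_pos : ∀ i j, 0 < a i j → 0 < σ i j
  σ_zero : ∀ i j, ¬ 0 < a i j → σ i j = 0
  κ : Fin N → ℝ
  κ_nonneg : ∀ i, 0 ≤ κ i
  c₁ : ℝ
  c₂ : ℝ
  β₁ : ℝ
  β₂ : ℝ
  f : Space n → Space n → Space n

/-- The Lipschitz condition on the intrinsic dynamics. -/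
def LipschitzCondition {n : ℕ} (f : Space n → Space n → Space n) : Prop :=
  ∃ ρ₁ ρ₂ : ℝ, 0 ≤ ρ₁ ∧ 0 ≤ ρ₂ ∧ ∀ x₁ x₂ v₁ v₂ : Space n,
    ‖f x₁ v₁ - f x₂ v₂‖ ≤ ρ₁ * ‖x₁ - x₂‖ + ρ₂ * ‖v₁ - v₂‖

/-- The leader `x₀' = v₀`, `v₀' = f(x₀, v₀)`, on the time interval `[-τ, ∞)` on which the lagged
reference `x₀(t - τ)`, `t ≥ 0`, looks at it. -/
structure IsLeader {n : ℕ} (f : Space n → Space n → Space n) (τ : ℝ) (x₀ v₀ : ℝ → Space n) :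
    Prop where
  pos : ∀ t, -τ ≤ t → HasDerivWithinAt x₀ (v₀ t) (Ici (-τ)) t
  vel : ∀ t, -τ ≤ t → HasDerivWithinAt v₀ (f (x₀ t) (v₀ t)) (Ici (-τ)) t

/-- A formal signal `signal + noise · w(t)` driven by the scalar white noise `w = dW/dt`. -/
structure NoisySignal (n : ℕ) where
  signal : Space n
  noise : Space n

namespace Network

variable {N n : ℕ} (M : Network N n)

/-- The neighbours of agent `i`. -/
def neighbors (i : Fin N) : Finset (Fin N) := by
  classical exact Finset.univ.filter fun j => 0 < M.a i j

/-- The digital twin's perception `z_j^x = x_j + β₁ σᵢⱼ (x_j - xᵢ) w` by agent `i` of the position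
of agent `j`. -/
def perceivedPos (y : FollowerState N n) (i j : Fin N) : NoisySignal n where
  signal := y.1 j
  noise := (M.β₁ * M.σ i j) • (y.1 j - y.1 i)

/-- The digital twin's perception `z_j^v = v_j + β₂ σᵢⱼ (v_j - vᵢ) w` by agent `i` of the velocity
of agent `j`. -/
def perceivedVel (y : FollowerState N n) (i j : Fin N) : NoisySignal n where
  signal := y.2 j
  noise := (M.β₂ * M.σ i j) • (y.2 j - y.2 i)

/-- The control input `uᵢ` on control-active intervals, given the lagged leader state
`p = x₀(t - τ)`, `q = v₀(t - τ)`: feedback on the lag error, and the noise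
`-∑_{j ∈ 𝒩ᵢ} σᵢⱼ (β₁ (xᵢ - x_j) + β₂ (vᵢ - v_j)) w`. -/
def control (p q : Space n) (y : FollowerState N n) (i : Fin N) : NoisySignal n where
  signal := -(M.κ i • (M.c₁ • (y.1 i - p) + M.c₂ • (y.2 i - q)))
  noise := -∑ j ∈ M.neighbors i,
    M.σ i j • (M.β₁ • (y.1 i - y.1 j) + M.β₂ • (y.2 i - y.2 j))

/-- The noise in the control input is the total perception noise of the neighbours' states. -/
theorem control_noise_eq (p q : Space n) (y : FollowerState N n) (i : Fin N) :
    (M.control p q y i).noise =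
      ∑ j ∈ M.neighbors i, ((M.perceivedPos y i j).noise + (M.perceivedVel y i j).noise) := by
  simp only [control, perceivedPos, perceivedVel, ← Finset.sum_neg_distrib]
  refine Finset.sum_congr rfl fun j _ => ?_
  module

/-- The drift of the followers, for the noise-free part `u` of the control input: `xᵢ' = vᵢ` and
`vᵢ' = f(xᵢ, vᵢ) + c₁ ∑_{j ∈ 𝒩ᵢ} aᵢⱼ (x_j - xᵢ) + c₂ ∑_{j ∈ 𝒩ᵢ} aᵢⱼ (v_j - vᵢ) + uᵢ`. -/
def followerDrift (u : Fin N → Space n) (y : FollowerState N n) : FollowerState N n :=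
  (y.2, fun i => M.f (y.1 i) (y.2 i)
    + M.c₁ • ∑ j ∈ M.neighbors i, M.a i j • (y.1 j - y.1 i)
    + M.c₂ • ∑ j ∈ M.neighbors i, M.a i j • (y.2 j - y.2 i)
    + u i)

/-- The graph Laplacian `L`. -/
def L : Matrix (Fin N) (Fin N) ℝ :=
  Matrix.of fun i j => if i = j then ∑ k ∈ Finset.univ.erase i, M.a i k else -M.a i j

/-- The pinning matrix `K = diag(κ₁, …, κ_N)`. -/
def K : Matrix (Fin N) (Fin N) ℝ := Matrix.diagonal M.κ

/-- The noise Laplacian `D`. -/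
def D : Matrix (Fin N) (Fin N) ℝ :=
  Matrix.of fun i j => if i = j then ∑ k, M.σ i k else -M.σ i j

/-- The matrix `H₁`, with blocks `0, I` and `-c₁ (L + K), -c₂ (L + K)`. -/
def H₁ : Matrix (Fin N ⊕ Fin N) (Fin N ⊕ Fin N) ℝ :=
  Matrix.fromBlocks 0 1 (-(M.c₁ • (M.L + M.K))) (-(M.c₂ • (M.L + M.K)))

/-- The matrix `H₂`, with blocks `0, I` and `-c₁ L, -c₂ L`. -/
def H₂ : Matrix (Fin N ⊕ Fin N) (Fin N ⊕ Fin N) ℝ :=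
  Matrix.fromBlocks 0 1 (-(M.c₁ • M.L)) (-(M.c₂ • M.L))

/-- The matrix `U`, with blocks `0, 0` and `β₁ D, β₂ D`. -/
def U : Matrix (Fin N ⊕ Fin N) (Fin N ⊕ Fin N) ℝ :=
  Matrix.fromBlocks 0 0 (M.β₁ • M.D) (M.β₂ • M.D)

end Network

section ErrorSystem

variable {N n : ℕ}

/-- The vector `(B ⊗ Iₙ) ξ`. -/
def kronApply (B : Matrix (Fin N ⊕ Fin N) (Fin N ⊕ Fin N) ℝ) (ξ : ErrorSpace N n) :
    ErrorSpace N n :=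
  WithLp.toLp 2 (Matrix.mulVec (B ⊗ₖ (1 : Matrix (Fin n) (Fin n) ℝ)) ξ.ofLp)

/-- The vector of `ℝ^{2Nn}` with position blocks `x i` and velocity blocks `v i`. -/
def stack (x v : Fin N → Space n) : ErrorSpace N n :=
  WithLp.toLp 2 fun p => Sum.elim (fun i => x i p.2) (fun i => v i p.2) p.1

/-- The `i`-th position block of a stacked vector. -/
def posBlock (ξ : ErrorSpace N n) (i : Fin N) : Space n :=
  WithLp.toLp 2 fun l => ξ (Sum.inl i, l)

/-- The `i`-th velocity block of a stacked vector. -/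
def velBlock (ξ : ErrorSpace N n) (i : Fin N) : Space n :=
  WithLp.toLp 2 fun l => ξ (Sum.inr i, l)

/-- The stacked lag error of the followers' state `y` relative to the lagged leader state
`p = x₀(t - τ)`, `q = v₀(t - τ)`. -/
def lagError (p q : Space n) (y : FollowerState N n) : ErrorSpace N n :=
  stack (fun i => y.1 i - p) (fun i => y.2 i - q)

/-- `F̃_τ`, as a function of the error `ξ` and of the lagged leader state `(p, q)`: its position part
is `0`, its velocity part consists of `f(xᵢ, vᵢ) - f(p, q)`, where `xᵢ = x̃ᵢ + p`, `vᵢ = ṽᵢ + q`. -/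
def Network.Ftilde (M : Network N n) (p q : Space n) (ξ : ErrorSpace N n) : ErrorSpace N n :=
  stack 0 fun i => M.f (posBlock ξ i + p) (velBlock ξ i + q) - M.f p q

end ErrorSystem

/-! ### Closed loop, error dynamics, lag consensus and mean-square stability -/

section Dynamics

variable {N n : ℕ} (M : Network N n) (τ : ℝ) (S : Schedule)
  {Ω : Type*} [mΩ : MeasurableSpace Ω] (P : Measure Ω) (𝓕 : Filtration ℝ≥0 mΩ) (W : ℝ≥0 → Ω → ℝ)

/-- `y = (x, v)` is a motion of the followers under the lag consensus protocol: the input is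
`Network.control` on the active intervals, and `0` on the failure intervals. -/
def IsFollowerSolution (x₀ v₀ : ℝ → Space n) (y : ℝ≥0 → Ω → FollowerState N n) : Prop :=
  IsPiecewiseSolution 𝓕 W P S
    (fun t y => M.followerDrift (fun i => (M.control (x₀ (t - τ)) (v₀ (t - τ)) y i).signal) y)
    (fun t y => (0, fun i => (M.control (x₀ (t - τ)) (v₀ (t - τ)) y i).noise))
    (fun _ y => M.followerDrift 0 y)
    y

/-- `ξ` solves the stochastic error dynamics
`dξ = (F̃_τ + (H₁ ⊗ Iₙ) ξ) dt - (U ⊗ Iₙ) ξ dW` on the active intervals,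
`dξ = (F̃_τ + (H₂ ⊗ Iₙ) ξ) dt` on the failure intervals. -/
def IsErrorSolution (x₀ v₀ : ℝ → Space n) (ξ : ℝ≥0 → Ω → ErrorSpace N n) : Prop :=
  IsPiecewiseSolution 𝓕 W P S
    (fun t ξ => M.Ftilde (x₀ (t - τ)) (v₀ (t - τ)) ξ + kronApply M.H₁ ξ)
    (fun _ ξ => -kronApply M.U ξ)
    (fun t ξ => M.Ftilde (x₀ (t - τ)) (v₀ (t - τ)) ξ + kronApply M.H₂ ξ)
    ξ

/-- For the given leader trajectory and all initial states of the followers, the position and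
velocity lag errors of every follower tend to `0` in mean square. -/
def LagConsensusAlong (x₀ v₀ : ℝ → Space n) : Prop :=
  ∀ y : ℝ≥0 → Ω → FollowerState N n, IsFollowerSolution M τ S P 𝓕 W x₀ v₀ y →
    ∀ i : Fin N,
      Tendsto (fun t : ℝ≥0 => ∫⁻ ω, ‖(y t ω).1 i - x₀ (t - τ)‖ₑ ^ 2 ∂P) atTop (𝓝 0) ∧
      Tendsto (fun t : ℝ≥0 => ∫⁻ ω, ‖(y t ω).2 i - v₀ (t - τ)‖ₑ ^ 2 ∂P) atTop (𝓝 0)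

/-- For the given leader trajectory, the error dynamics is mean-square (asymptotically) stable:
`𝔼‖ξ(t)‖² → 0` for all initial errors. -/
def MeanSquareStableAlong (x₀ v₀ : ℝ → Space n) : Prop :=
  ∀ ξ : ℝ≥0 → Ω → ErrorSpace N n, IsErrorSolution M τ S P 𝓕 W x₀ v₀ ξ →
    Tendsto (fun t : ℝ≥0 => ∫⁻ ω, ‖ξ t ω‖ₑ ^ 2 ∂P) atTop (𝓝 0)

/-- Mean-square lag consensus, for all initial states of the leader and of the followers. -/
def MeanSquareLagConsensus : Prop :=
  ∀ x₀ v₀ : ℝ → Space n, IsLeader M.f τ x₀ v₀ → LagConsensusAlong M τ S P 𝓕 W x₀ v₀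

/-- Mean-square stability of the error dynamics, for all leader trajectories. -/
def MeanSquareStable : Prop :=
  ∀ x₀ v₀ : ℝ → Space n, IsLeader M.f τ x₀ v₀ → MeanSquareStableAlong M τ S P 𝓕 W x₀ v₀

end Dynamics

end

end LagConsensus

/-! The lag error is `ξ = T y + m(t)`, where `T` (`stackEquiv`) merely stacks positions and
velocities and `m` is minus the stacked lagged leader state: an invertible affine change of
variables with deterministic C¹ shift. Such a change carries solutions to solutions
(`IsPiecewiseSolution.affine`): the Itô integral commutes with continuous linear maps, and `m`
contributes only `m'` to the drift. What is needed is that the coefficients correspond, `b'(t, T y +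
m) = T b(t, y) + m'` and `g'(t, T y + m) = T g(t, y)`.

These identities (`Ftilde_add_H₁`, `Ftilde_add_H₂`, `neg_kronApply_U`) hold because coupling and
noise see only differences between agents, from which the common shift cancels, while pinning acts
on the lag error itself and `F̃_τ` absorbs the leader's acceleration. Using `T` one way and its
inverse the other gives the equivalence of solutions.

For the moments, `‖ξ‖²` is the finite sum of the squared norms of its blocks (`enorm_sq_stack`), so
its expectation tends to zero exactly when each block's does. -/

namespace LagConsensus

/-! ### Itô integrals and solutions under affine maps -/

section Transport

variable {Ω : Type*} [mΩ : MeasurableSpace Ω] {𝓕 : Filtration ℝ≥0 mΩ} {W : ℝ≥0 → Ω → ℝ}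
  {P : Measure Ω} {E F : Type*} [NormedAddCommGroup E] [NormedSpace ℝ E]
  [NormedAddCommGroup F] [NormedSpace ℝ F]

/-- The image of a simple process under a continuous linear map. -/
def SimpleProcess.map (T : E →L[ℝ] F) (H : SimpleProcess 𝓕 E) : SimpleProcess 𝓕 F where
  num := H.num
  time := H.time
  time_mono := H.time_mono
  val i ω := T (H.val i ω)
  val_meas i := T.continuous.comp_stronglyMeasurable (H.val_meas i)
  val_bdd := by
    obtain ⟨C, hC⟩ := H.val_bdd
    exact ⟨‖T‖ * C, fun i ω => (T.le_opNorm _).trans (by gcongr; exact hC i ω)⟩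

theorem SimpleProcess.eval_map (T : E →L[ℝ] F) (H : SimpleProcess 𝓕 E) (t : ℝ≥0) (ω : Ω) :
    (H.map T).eval t ω = T (H.eval t ω) := by
  simp only [SimpleProcess.eval, SimpleProcess.map, map_sum]
  refine Finset.sum_congr rfl fun i _ => ?_
  by_cases ht : t ∈ Ioc (H.time i) (H.time (i + 1))
  · rw [indicator_of_mem ht, indicator_of_mem ht]
  · rw [indicator_of_notMem ht, indicator_of_notMem ht, map_zero]

theorem SimpleProcess.integral_map (T : E →L[ℝ] F) (H : SimpleProcess 𝓕 E) (a b : ℝ≥0) (ω : Ω) :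
    (H.map T).integral W a b ω = T (H.integral W a b ω) := by
  simp [SimpleProcess.integral, SimpleProcess.map]

theorem tendstoInMeasure_clm (T : E →L[ℝ] F) {u : ℕ → Ω → E} {I : Ω → E}
    (h : TendstoInMeasure P u atTop I) :
    TendstoInMeasure P (fun k ω => T (u k ω)) atTop (fun ω => T (I ω)) := by
  rw [tendstoInMeasure_iff_norm] at h ⊢
  intro ε hε
  -- The extra 1 keeps the divisor positive when `T = 0`.
  have hC : 0 < ‖T‖ + 1 := by positivity
  refine tendsto_of_tendsto_of_tendsto_of_le_of_le tendsto_const_nhds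
    (h (ε / (‖T‖ + 1)) (by positivity)) (fun _ => zero_le) fun k => measure_mono fun ω hω => ?_
  simp only [mem_ofPred_eq] at hω ⊢
  rw [div_le_iff₀ hC]
  rw [← map_sub] at hω
  nlinarith [T.le_opNorm (u k ω - I ω), norm_nonneg (u k ω - I ω)]

/-- The images under `T` of the approximating simple processes approximate `T G`: the squared error
grows by at most `(‖T‖ + 1)²`, and elementary integrals commute with `T`. -/
theorem IsItoIntegral.clm (T : E →L[ℝ] F) {G : ℝ≥0 → Ω → E} {a b : ℝ≥0} {I : Ω → E}
    (h : IsItoIntegral 𝓕 W P G a b I) :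
    IsItoIntegral 𝓕 W P (fun r ω => T (G r ω)) a b (fun ω => T (I ω)) := by
  obtain ⟨H, hH, hI⟩ := h
  refine ⟨fun k => (H k).map T, fun ε hε => ?_, ?_⟩
  · set C : ℝ≥0∞ := ((‖T‖₊ + 1 : ℝ≥0) : ℝ≥0∞) ^ 2 with hC
    have hC0 : C ≠ 0 := by simp [hC]
    have hCt : C ≠ ⊤ := by simp [hC]
    refine tendsto_of_tendsto_of_tendsto_of_le_of_le tendsto_const_nhds
      (hH (ε / C) (ENNReal.div_pos hε.ne' hCt)) (fun _ => zero_le)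
      fun k => measure_mono fun ω hω => ?_
    simp only [mem_ofPred_eq] at hω ⊢
    -- Finiteness of `C` lets it leave the integral without any measurability of `G` in time.
    rw [ENNReal.div_le_iff hC0 hCt, mul_comm, ← lintegral_const_mul' _ _ hCt]
    refine hω.trans (lintegral_mono fun r => ?_)
    rw [SimpleProcess.eval_map, ← map_sub, hC, ← mul_pow]
    gcongr
    refine (T.le_opENorm _).trans ?_
    gcongr
    rw [enorm_eq_nnnorm]
    exact_mod_cast le_self_add
  · have : (fun k => ((H k).map T).integral W a b) =
        fun k ω => T ((H k).integral W a b ω) := by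
      ext k ω
      exact SimpleProcess.integral_map T (H k) a b ω
    rw [this]
    exact tendstoInMeasure_clm T hI

/-- An affine image `T y + m` of a solution, with `m` deterministic and continuously
differentiable, solves the transformed piecewise system. -/
theorem IsPiecewiseSolution.affine [IsProbabilityMeasure P] [CompleteSpace E] [CompleteSpace F]
    {S : Schedule} {b₁ g₁ b₂ : ℝ≥0 → E → E} {b₁' g₁' b₂' : ℝ≥0 → F → F} {y : ℝ≥0 → Ω → E}
    (T : E →L[ℝ] F) {m m' : ℝ≥0 → F}
    (hm : ∀ t : ℝ≥0, HasDerivWithinAt (fun r : ℝ => m r.toNNReal) (m' t) (Ici 0) t)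
    (hm' : Continuous m') (hb : Continuous fun p : ℝ≥0 × E => b₁ p.1 p.2)
    (hb₁ : ∀ t y, b₁' t (T y + m t) = T (b₁ t y) + m' t)
    (hg₁ : ∀ t y, g₁' t (T y + m t) = T (g₁ t y))
    (hb₂ : ∀ t y, b₂' t (T y + m t) = T (b₂ t y) + m' t)
    (h : IsPiecewiseSolution 𝓕 W P S b₁ g₁ b₂ y) :
    IsPiecewiseSolution 𝓕 W P S b₁' g₁' b₂' (fun t ω => T (y t ω) + m t) := by
  have hmc : ContinuousOn (fun r : ℝ => m r.toNNReal) (Ici 0) := fun r hr => by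
    have := (hm r.toNNReal).continuousWithinAt
    rwa [Real.coe_toNNReal r hr] at this
  have hmc' : Continuous m := by
    have := hmc.comp_continuous NNReal.continuous_coe fun r => r.2
    simpa [Function.comp_def] using this
  -- At 0 the derivative is only one-sided, since `toNNReal` clamps negative times. Continuity up to
  -- 0 and two-sided derivatives at positive times suffice for the fundamental theorem of calculus
  -- and for the failure intervals.
  have hmd : ∀ r : ℝ, 0 < r → HasDerivAt (fun r : ℝ => m r.toNNReal) (m' r.toNNReal) r := by
    intro r hr
    have := hm r.toNNReal
    rw [Real.coe_toNNReal r hr.le] at this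
    exact this.hasDerivAt (Ici_mem_nhds hr)
  refine ⟨fun t => ?_, ?_, ?_, fun k t ht => ?_, fun k => ?_⟩
  · exact (T.continuous.comp_stronglyMeasurable (h.adapted t)).add stronglyMeasurable_const
  · filter_upwards [h.continuous_paths] with ω hω
    exact (T.continuous.comp hω).add hmc'
  · exact (T.comp_memLp' h.initial).add (memLp_const _)
  · obtain ⟨I, hI, hy⟩ := h.active k t ht
    refine ⟨fun ω => T (I ω), ?_, ?_⟩
    · simpa only [hg₁] using hI.clm T
    · filter_upwards [hy, h.continuous_paths] with ω hω hc
      -- Continuity of the drift along a continuous path makes it integrable, as splitting the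
      -- integral of `T b₁ + m'` requires.
      have hint : IntervalIntegrable (fun r : ℝ => b₁ r.toNNReal (y r.toNNReal ω)) volume
          (S.t k) t :=
        (hb.comp (continuous_real_toNNReal.prodMk
          (hc.comp continuous_real_toNNReal))).intervalIntegrable _ _
      have hint' : IntervalIntegrable (fun r : ℝ => m' r.toNNReal) volume (S.t k) t :=
        (hm'.comp continuous_real_toNNReal).intervalIntegrable _ _
      have hle : ((S.t k : ℝ≥0) : ℝ) ≤ t := NNReal.coe_le_coe.2 ht.1
      have hftc : ∫ r in ((S.t k : ℝ≥0) : ℝ)..t, m' r.toNNReal = m t - m (S.t k) := by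
        rw [intervalIntegral.integral_eq_sub_of_hasDerivAt_of_le hle
          (hmc.mono fun r hr => (S.t k).2.trans hr.1)
          (fun r hr => hmd r ((S.t k).2.trans_lt hr.1)) hint']
        simp
      simp only [hb₁]
      rw [intervalIntegral.integral_add
        (by exact ⟨T.integrable_comp hint.1, T.integrable_comp hint.2⟩) hint', hftc,
        T.intervalIntegral_comp_comm hint, hω]
      simp only [map_add]
      abel
  · filter_upwards [h.failure k] with ω hω t ht
    rw [hb₂]
    have := hmd t (lt_of_le_of_lt (S.s k).2 (NNReal.coe_lt_coe.2 ht.1))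
    rw [Real.toNNReal_coe] at this
    exact (T.hasFDerivAt.comp_hasDerivAt (t : ℝ) (hω t ht)).add this

end Transport

noncomputable section

/-! ### Stacked vectors and Kronecker products in block form -/

section Stacking

variable {N n : ℕ}

@[simp]
theorem posBlock_stack (x v : Fin N → Space n) (i : Fin N) : posBlock (stack x v) i = x i := rfl

@[simp]
theorem velBlock_stack (x v : Fin N → Space n) (i : Fin N) : velBlock (stack x v) i = v i := rfl

theorem stack_blocks (ξ : ErrorSpace N n) : stack (posBlock ξ) (velBlock ξ) = ξ := by
  ext ⟨i | i, l⟩ <;> rfl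

theorem stack_add (x v x' v' : Fin N → Space n) :
    stack x v + stack x' v' = stack (x + x') (v + v') := by
  ext ⟨i | i, l⟩ <;> rfl

theorem stack_neg (x v : Fin N → Space n) : -stack x v = stack (-x) (-v) := by
  ext ⟨i | i, l⟩ <;> rfl

/-- Stacking positions and velocities, as a continuous linear equivalence. -/
def stackEquiv (N n : ℕ) : FollowerState N n ≃L[ℝ] ErrorSpace N n :=
  LinearEquiv.toContinuousLinearEquiv
    { toFun := fun y => stack y.1 y.2
      invFun := fun ξ => (posBlock ξ, velBlock ξ)
      map_add' := fun y z => (stack_add y.1 y.2 z.1 z.2).symm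
      map_smul' := fun c y => by ext ⟨i | i, l⟩ <;> rfl
      left_inv := fun _ => rfl
      right_inv := stack_blocks }

theorem stackEquiv_apply (y : FollowerState N n) : stackEquiv N n y = stack y.1 y.2 := rfl

/-- The lag error is the stacked state, shifted by the stacked lagged leader state. -/
theorem lagError_eq (p q : Space n) (y : FollowerState N n) :
    lagError p q y = stackEquiv N n y + -stackEquiv N n (fun _ => p, fun _ => q) := by
  simp only [stackEquiv_apply, stack_neg, stack_add, lagError, sub_eq_add_neg]
  rfl

theorem kronApply_fromBlocks (A B C D : Matrix (Fin N) (Fin N) ℝ) (x v : Fin N → Space n) :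
    kronApply (Matrix.fromBlocks A B C D) (stack x v) =
      stack (fun i => ∑ j, A i j • x j + ∑ j, B i j • v j)
        (fun i => ∑ j, C i j • x j + ∑ j, D i j • v j) := by
  ext ⟨i | i, l⟩ <;>
  simp [kronApply, stack, Matrix.mulVec, dotProduct, Fintype.sum_prod_type, Matrix.one_apply]

theorem enorm_sq_stack (x v : Fin N → Space n) :
    ‖stack x v‖ₑ ^ 2 = ∑ i, (‖x i‖ₑ ^ 2 + ‖v i‖ₑ ^ 2) := by
  have h : ‖stack x v‖ ^ 2 = ∑ i, (‖x i‖ ^ 2 + ‖v i‖ ^ 2) := by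
    simp only [EuclideanSpace.norm_sq_eq, Fintype.sum_prod_type, Fintype.sum_sum_type,
      Finset.sum_add_distrib]
    rfl
  have h' : ‖stack x v‖₊ ^ 2 = ∑ i, (‖x i‖₊ ^ 2 + ‖v i‖₊ ^ 2) := by
    apply NNReal.coe_injective
    push_cast
    exact h
  simp only [enorm_eq_nnnorm]
  exact_mod_cast h'

end Stacking

/-! ### Laplacian rows and correspondence of the coefficients -/

namespace Network

variable {N n : ℕ} (M : Network N n)

theorem σ_diag (i : Fin N) : M.σ i i = 0 := M.σ_zero i i (by simp [M.a_diag])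

theorem sum_neighbors (w : Fin N → ℝ) (i : Fin N) (hw : ∀ j, ¬ 0 < M.a i j → w j = 0)
    (x : Fin N → Space n) :
    ∑ j ∈ M.neighbors i, w j • x j = ∑ j, w j • x j := by
  refine Finset.sum_subset (Finset.subset_univ _) fun j _ hj => ?_
  rw [hw j (by simpa [neighbors] using hj), zero_smul]

/-- A row of a Laplacian matrix, applied to a vector. -/
theorem sum_laplacian (w : Fin N → ℝ) (i : Fin N) (hw : w i = 0) (x : Fin N → Space n) :
    ∑ j, (if i = j then ∑ k, w k else -w j) • x j = ∑ j, w j • (x i - x j) := by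
  have h : ∀ j, (if i = j then ∑ k, w k else -w j) • x j =
      (if i = j then (∑ k, w k) • x i else 0) - w j • x j := by
    intro j
    split_ifs with hij
    · subst hij
      simp [hw]
    · simp
  simp only [h, Finset.sum_sub_distrib, smul_sub, Finset.sum_ite_eq, Finset.mem_univ, if_true,
    Finset.sum_smul]

theorem sum_L (i : Fin N) (x : Fin N → Space n) :
    ∑ j, M.L i j • x j = -∑ j ∈ M.neighbors i, M.a i j • (x j - x i) := by
  rw [M.sum_neighbors (M.a i) i (fun j hj => le_antisymm (not_lt.1 hj) (M.a_nonneg i j)),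
    ← Finset.sum_neg_distrib]
  have := sum_laplacian (M.a i) i (M.a_diag i) x
  simp only [L, Matrix.of_apply]
  -- The diagonal of `L` omits `k = i`, which is harmless because `a i i = 0`.
  rw [Finset.sum_erase _ (M.a_diag i), this]
  exact Finset.sum_congr rfl fun j _ => by module

theorem sum_D (i : Fin N) (x : Fin N → Space n) :
    ∑ j, M.D i j • x j = ∑ j ∈ M.neighbors i, M.σ i j • (x i - x j) := by
  rw [M.sum_neighbors (M.σ i) i (M.σ_zero i)]
  exact sum_laplacian (M.σ i) i (M.σ_diag i) x

theorem sum_K (i : Fin N) (x : Fin N → Space n) : ∑ j, M.K i j • x j = M.κ i • x i := by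
  simp [K, Matrix.diagonal_apply, ite_smul]

theorem sum_one (i : Fin N) (x : Fin N → Space n) :
    ∑ j, (1 : Matrix (Fin N) (Fin N) ℝ) i j • x j = x i := by
  simp [Matrix.one_apply, ite_smul]

/-- Rows of `L` act through differences, so `p` and `q` drop out of the coupling; they survive only
as the leader's velocity `q` and acceleration `f(p, q)`. -/
theorem Ftilde_add_H₂ (p q : Space n) (y : FollowerState N n) :
    M.Ftilde p q (lagError p q y) + kronApply M.H₂ (lagError p q y) =
      stackEquiv N n (M.followerDrift 0 y)
        + -stackEquiv N n (fun _ => q, fun _ => M.f p q) := by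
  simp only [lagError, Ftilde, H₂, kronApply_fromBlocks, stackEquiv_apply, stack_neg, stack_add,
    posBlock_stack, velBlock_stack, followerDrift, Matrix.neg_apply, Matrix.smul_apply, neg_smul,
    smul_assoc, Finset.sum_neg_distrib, ← Finset.smul_sum, sum_L, sum_one, sub_sub_sub_cancel_right,
    sub_add_cancel]
  congr 1 <;> funext i
  · simp [sub_eq_add_neg]
  · simp only [Pi.add_apply, Pi.neg_apply, Pi.zero_apply]
    module

/-- As on failure intervals, with the additional `K` terms reproducing the feedback on the lag
error. -/
theorem Ftilde_add_H₁ (p q : Space n) (y : FollowerState N n) :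
    M.Ftilde p q (lagError p q y) + kronApply M.H₁ (lagError p q y) =
      stackEquiv N n (M.followerDrift (fun i => (M.control p q y i).signal) y)
        + -stackEquiv N n (fun _ => q, fun _ => M.f p q) := by
  simp only [lagError, Ftilde, H₁, kronApply_fromBlocks, stackEquiv_apply, stack_neg, stack_add,
    posBlock_stack, velBlock_stack, followerDrift, Matrix.neg_apply, Matrix.smul_apply, neg_smul,
    smul_assoc, Finset.sum_neg_distrib, ← Finset.smul_sum, Matrix.add_apply, add_smul,
    Finset.sum_add_distrib, sum_L, sum_K, sum_one, sub_sub_sub_cancel_right,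
    sub_add_cancel, control]
  congr 1 <;> funext i
  · simp [sub_eq_add_neg]
  · simp only [Pi.add_apply, Pi.neg_apply]
    module

/-- The control noise does not involve the leader state, so `p'`, `q'` are arbitrary. -/
theorem neg_kronApply_U (p q p' q' : Space n) (y : FollowerState N n) :
    -kronApply M.U (lagError p q y) =
      stackEquiv N n (0, fun i => (M.control p' q' y i).noise) := by
  simp only [lagError, U, kronApply_fromBlocks, stackEquiv_apply, stack_neg, Matrix.smul_apply,
    smul_assoc, ← Finset.smul_sum, sum_D, sub_sub_sub_cancel_right, control, Matrix.zero_apply,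
    zero_smul, Finset.sum_const_zero, add_zero]
  congr 1 <;> funext i
  · simp
  · simp only [Pi.neg_apply, smul_add, Finset.sum_add_distrib, smul_comm _ M.β₁, smul_comm _ M.β₂,
      Finset.smul_sum]

theorem continuous_f (hf : LipschitzCondition M.f) :
    Continuous fun z : Space n × Space n => M.f z.1 z.2 := by
  obtain ⟨ρ₁, ρ₂, -, -, h⟩ := hf
  rw [continuous_iff_continuousAt]
  intro z
  rw [ContinuousAt, tendsto_iff_norm_sub_tendsto_zero]
  refine squeeze_zero (fun _ => norm_nonneg _) (fun w => h w.1 z.1 w.2 z.2) ?_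
  have : Continuous fun w : Space n × Space n => ρ₁ * ‖w.1 - z.1‖ + ρ₂ * ‖w.2 - z.2‖ := by
    fun_prop
  simpa using this.tendsto z

end Network

/-! ### Regularity of the lagged leader -/

section Leader

variable {n : ℕ} {f : Space n → Space n → Space n} {τ : ℝ} {x₀ v₀ : ℝ → Space n}

/-- The shift by `τ` maps `[0, ∞)` into `[-τ, ∞)`, where the leader equation holds. The `toNNReal`
form is the one `IsPiecewiseSolution.affine` asks of its shift. -/
theorem hasDerivWithinAt_lag {x x' : ℝ → Space n}
    (h : ∀ t, -τ ≤ t → HasDerivWithinAt x (x' t) (Ici (-τ)) t) (t : ℝ≥0) :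
    HasDerivWithinAt (fun r : ℝ => x ((r.toNNReal : ℝ) - τ)) (x' (t - τ)) (Ici 0) t := by
  have h₁ : HasDerivWithinAt (fun r : ℝ => x (r - τ)) (x' (t - τ)) (Ici 0) t := by
    have := (h (t - τ) (by linarith [t.2])).scomp (t : ℝ)
      (((hasDerivAt_id (t : ℝ)).sub_const τ).hasDerivWithinAt (s := Ici 0))
      (fun r (hr : 0 ≤ r) => by simpa using hr)
    simpa [Function.comp_def] using this
  refine h₁.congr (fun r hr => ?_) ?_
  · rw [Real.coe_toNNReal r hr]
  · simp

theorem continuous_lag {x x' : ℝ → Space n}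
    (h : ∀ t, -τ ≤ t → HasDerivWithinAt x (x' t) (Ici (-τ)) t) :
    Continuous fun t : ℝ≥0 => x (t - τ) := by
  have : ContinuousOn x (Ici (-τ)) := fun t ht => (h t ht).continuousWithinAt
  exact this.comp_continuous (by fun_prop) fun t => by
    simp

end Leader

/-! ### Equivalence of solutions and of the stability notions -/

section Equivalence

variable {N n : ℕ} {M : Network N n} {τ : ℝ} {S : Schedule} {Ω : Type*} [mΩ : MeasurableSpace Ω]
  {P : Measure Ω} {𝓕 : Filtration ℝ≥0 mΩ} {W : ℝ≥0 → Ω → ℝ} {x₀ v₀ : ℝ → Space n}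

theorem continuous_const_pair {X : Type*} [TopologicalSpace X] {u v : X → Space n}
    (hu : Continuous u) (hv : Continuous v) :
    Continuous fun x => ((fun _ => u x, fun _ => v x) : FollowerState N n) :=
  (continuous_pi fun _ => hu).prodMk (continuous_pi fun _ => hv)

/-- The derivative of the stacked lagged leader state. -/
theorem IsLeader.hasDerivWithinAt_stack (h : IsLeader M.f τ x₀ v₀) (t : ℝ≥0) :
    HasDerivWithinAt
      (fun r : ℝ => stackEquiv N n (fun _ => x₀ ((r.toNNReal : ℝ) - τ),
        fun _ => v₀ ((r.toNNReal : ℝ) - τ)))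
      (stackEquiv N n (fun _ => v₀ (t - τ), fun _ => M.f (x₀ (t - τ)) (v₀ (t - τ))))
      (Ici 0) t := by
  have h₁ := hasDerivWithinAt_lag h.pos t
  have h₂ := hasDerivWithinAt_lag h.vel t
  exact (stackEquiv N n).hasFDerivAt.comp_hasDerivWithinAt (t : ℝ)
    ((hasDerivWithinAt_pi.2 fun _ => h₁).prodMk (hasDerivWithinAt_pi.2 fun _ => h₂))

theorem isFollowerSolution_iff_isErrorSolution [IsProbabilityMeasure P]
    (hf : LipschitzCondition M.f) (h : IsLeader M.f τ x₀ v₀)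
    (y : ℝ≥0 → Ω → FollowerState N n) :
    IsFollowerSolution M τ S P 𝓕 W x₀ v₀ y ↔
      IsErrorSolution M τ S P 𝓕 W x₀ v₀
        (fun t ω => lagError (x₀ (t - τ)) (v₀ (t - τ)) (y t ω)) := by
  have hx := continuous_lag h.pos
  have hv := continuous_lag h.vel
  have hfc := M.continuous_f hf
  have hflag : Continuous fun t : ℝ≥0 => M.f (x₀ (t - τ)) (v₀ (t - τ)) := hfc.comp (hx.prodMk hv)
  have hm' : Continuous fun t : ℝ≥0 =>
      stackEquiv N n (fun _ => v₀ (t - τ), fun _ => M.f (x₀ (t - τ)) (v₀ (t - τ))) :=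
    (stackEquiv N n).continuous.comp (continuous_const_pair hv hflag)
  have hdrift : Continuous fun p : ℝ≥0 × FollowerState N n => M.followerDrift
      (fun i => (M.control (x₀ (p.1 - τ)) (v₀ (p.1 - τ)) p.2 i).signal) p.2 := by
    have hf' : ∀ i, Continuous fun p : ℝ≥0 × FollowerState N n => M.f (p.2.1 i) (p.2.2 i) :=
      fun i => hfc.comp (f := fun p : ℝ≥0 × FollowerState N n => (p.2.1 i, p.2.2 i)) (by fun_prop)
    have hx' : Continuous fun p : ℝ≥0 × FollowerState N n => x₀ (p.1 - τ) := hx.comp continuous_fst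
    have hv' : Continuous fun p : ℝ≥0 × FollowerState N n => v₀ (p.1 - τ) := hv.comp continuous_fst
    simp only [Network.followerDrift, Network.control]
    refine (by fun_prop : Continuous fun p : ℝ≥0 × FollowerState N n => p.2.2).prodMk
      (continuous_pi fun i => ?_)
    refine (((hf' i).add ?_).add ?_).add (((Continuous.sub ?_ hx').const_smul M.c₁).add
      ((Continuous.sub ?_ hv').const_smul M.c₂) |>.const_smul (M.κ i)).neg
    all_goals fun_prop
  constructor
  · intro hy
    simp only [lagError_eq]
    refine IsPiecewiseSolution.affine (stackEquiv N n : FollowerState N n →L[ℝ] ErrorSpace N n)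
      (fun t => (h.hasDerivWithinAt_stack t).neg) hm'.neg hdrift ?_ ?_ ?_ hy
    all_goals
      intro t z
      rw [ContinuousLinearEquiv.coe_coe, ← lagError_eq]
    · exact M.Ftilde_add_H₁ _ _ _
    · exact M.neg_kronApply_U _ _ _ _ _
    · exact M.Ftilde_add_H₂ _ _ _
  · intro hy
    -- Every vector is the lag error of some state, so the coefficient identities, stated for lag
    -- errors, apply at every `ξ`.
    have hback : ∀ (t : ℝ≥0) (ξ : ErrorSpace N n), ξ = lagError (x₀ (t - τ)) (v₀ (t - τ))
        ((stackEquiv N n).symm ξ + (fun _ => x₀ (t - τ), fun _ => v₀ (t - τ))) := by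
      intro t ξ
      simp [lagError_eq]
    have key := IsPiecewiseSolution.affine (F := FollowerState N n)
      (b₁' := fun t y => M.followerDrift
        (fun i => (M.control (x₀ (t - τ)) (v₀ (t - τ)) y i).signal) y)
      (g₁' := fun t y => (0, fun i => (M.control (x₀ (t - τ)) (v₀ (t - τ)) y i).noise))
      (b₂' := fun _ y => M.followerDrift 0 y)
      ((stackEquiv N n).symm : ErrorSpace N n →L[ℝ] FollowerState N n)
      (m := fun t => (fun _ => x₀ (t - τ), fun _ => v₀ (t - τ)))
      (m' := fun t => (fun _ => v₀ (t - τ), fun _ => M.f (x₀ (t - τ)) (v₀ (t - τ))))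
      (fun t => (hasDerivWithinAt_pi.2 fun _ => hasDerivWithinAt_lag h.pos t).prodMk
        (hasDerivWithinAt_pi.2 fun _ => hasDerivWithinAt_lag h.vel t))
      (continuous_const_pair hv hflag) ?_ ?_ ?_ ?_ hy
    · simp only [lagError_eq, ContinuousLinearEquiv.coe_coe, map_add, map_neg,
        ContinuousLinearEquiv.symm_apply_apply, neg_add_cancel_right] at key
      exact key
    · have : ∀ p : ℝ≥0 × ErrorSpace N n, _ = _ := fun p => M.Ftilde_add_H₁ (x₀ (p.1 - τ))
        (v₀ (p.1 - τ)) ((stackEquiv N n).symm p.2 + (fun _ => x₀ (p.1 - τ), fun _ => v₀ (p.1 - τ)))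
      simp only [← hback] at this
      simp only [this]
      refine ((stackEquiv N n).continuous.comp (hdrift.comp (continuous_fst.prodMk ?_))).add
        (hm'.neg.comp continuous_fst)
      have hx' : Continuous fun p : ℝ≥0 × ErrorSpace N n => x₀ (p.1 - τ) := hx.comp continuous_fst
      have hv' : Continuous fun p : ℝ≥0 × ErrorSpace N n => v₀ (p.1 - τ) := hv.comp continuous_fst
      exact ((stackEquiv N n).symm.continuous.comp continuous_snd).add
        (continuous_const_pair hx' hv')
    all_goals
      intro t ξ
      simp only [ContinuousLinearEquiv.coe_coe]
      conv_rhs => rw [hback t ξ]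
    · rw [M.Ftilde_add_H₁]
      simp only [map_add, map_neg, ContinuousLinearEquiv.symm_apply_apply, neg_add_cancel_right]
    · rw [M.neg_kronApply_U _ _ (x₀ (t - τ)) (v₀ (t - τ))]
      simp
    · rw [M.Ftilde_add_H₂]
      simp only [map_add, map_neg, ContinuousLinearEquiv.symm_apply_apply, neg_add_cancel_right]

theorem lagConsensusAlong_iff [IsProbabilityMeasure P] (hf : LipschitzCondition M.f)
    (h : IsLeader M.f τ x₀ v₀) :
    LagConsensusAlong M τ S P 𝓕 W x₀ v₀ ↔ MeanSquareStableAlong M τ S P 𝓕 W x₀ v₀ := by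
  constructor
  · intro hc ξ hξ
    -- Undoing the change of variables shows that every error solution comes from a follower
    -- solution.
    set y : ℝ≥0 → Ω → FollowerState N n := fun t ω =>
      (stackEquiv N n).symm (ξ t ω) + (fun _ => x₀ (t - τ), fun _ => v₀ (t - τ)) with hy
    have hξy : (fun (t : ℝ≥0) ω => lagError (x₀ (t - τ)) (v₀ (t - τ)) (y t ω)) = ξ := by
      simp [hy, lagError_eq]
    have hys : IsFollowerSolution M τ S P 𝓕 W x₀ v₀ y := by
      rw [isFollowerSolution_iff_isErrorSolution hf h, hξy]
      exact hξ
    -- Additivity of the lower integral needs measurability, supplied by adaptedness; the converse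
    -- direction uses only monotonicity.
    have hmeas : ∀ t, StronglyMeasurable (y t) := fun t => (hys.adapted t).mono (𝓕.le t)
    have hmx : ∀ t i, Measurable fun ω => ‖(y t ω).1 i - x₀ (t - τ)‖ₑ ^ 2 := fun t i =>
      (((((continuous_apply i).comp continuous_fst).comp_stronglyMeasurable (hmeas t)).sub
        stronglyMeasurable_const).enorm).pow_const 2
    have hmv : ∀ t i, Measurable fun ω => ‖(y t ω).2 i - v₀ (t - τ)‖ₑ ^ 2 := fun t i =>
      (((((continuous_apply i).comp continuous_snd).comp_stronglyMeasurable (hmeas t)).sub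
        stronglyMeasurable_const).enorm).pow_const 2
    have hint : ∀ t : ℝ≥0, ∫⁻ ω, ‖ξ t ω‖ₑ ^ 2 ∂P =
        ∑ i, (∫⁻ ω, ‖(y t ω).1 i - x₀ (t - τ)‖ₑ ^ 2 ∂P
          + ∫⁻ ω, ‖(y t ω).2 i - v₀ (t - τ)‖ₑ ^ 2 ∂P) := by
      intro t
      rw [← hξy]
      simp only [lagError, enorm_sq_stack]
      exact (lintegral_finsetSum _ fun i _ => (hmx t i).add (hmv t i)).trans
        (Finset.sum_congr rfl fun i _ => lintegral_add_left (hmx t i) _)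
    simp only [hint]
    simpa using tendsto_finsetSum Finset.univ fun i _ => (hc y hys i).1.add (hc y hys i).2
  · intro hs y hy i
    have := hs _ ((isFollowerSolution_iff_isErrorSolution hf h y).1 hy)
    simp only [lagError, enorm_sq_stack] at this
    constructor
    all_goals
      refine tendsto_of_tendsto_of_tendsto_of_le_of_le tendsto_const_nhds this
        (fun _ => zero_le) fun t => lintegral_mono fun ω => ?_
      refine le_trans ?_ (Finset.single_le_sum (fun _ _ => zero_le) (Finset.mem_univ i))
    · exact le_self_add
    · exact le_add_self

end Equivalence

end

end LagConsensus

theorem proposition1 {N n : ℕ} (M : LagConsensus.Network N n)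
    (hf : LagConsensus.LipschitzCondition M.f) (τ : ℝ) (hτ : 0 ≤ τ) (S : LagConsensus.Schedule)
    {Ω : Type*} [mΩ : MeasurableSpace Ω] (P : Measure Ω) [IsProbabilityMeasure P]
    (𝓕 : Filtration ℝ≥0 mΩ) (W : ℝ≥0 → Ω → ℝ) (hW : LagConsensus.IsFilteredBrownian 𝓕 W P) :
    (∀ x₀ v₀ : ℝ → LagConsensus.Space n, LagConsensus.IsLeader M.f τ x₀ v₀ →
      (∀ y : ℝ≥0 → Ω → LagConsensus.FollowerState N n,
        LagConsensus.IsFollowerSolution M τ S P 𝓕 W x₀ v₀ y ↔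
          LagConsensus.IsErrorSolution M τ S P 𝓕 W x₀ v₀
            (fun t ω => LagConsensus.lagError (x₀ (t - τ)) (v₀ (t - τ)) (y t ω))) ∧
      (LagConsensus.LagConsensusAlong M τ S P 𝓕 W x₀ v₀ ↔
        LagConsensus.MeanSquareStableAlong M τ S P 𝓕 W x₀ v₀)) ∧
    (LagConsensus.MeanSquareLagConsensus M τ S P 𝓕 W ↔
      LagConsensus.MeanSquareStable M τ S P 𝓕 W) := by
  have key := fun x₀ v₀ (h : LagConsensus.IsLeader M.f τ x₀ v₀) =>
    LagConsensus.lagConsensusAlong_iff (S := S) (P := P) (𝓕 := 𝓕) (W := W) hf h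
  exact ⟨fun x₀ v₀ h =>
      ⟨LagConsensus.isFollowerSolution_iff_isErrorSolution hf h, key x₀ v₀ h⟩,
    forall₃_congr key⟩
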